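/- Let $\mathbb{D}_{nd}$ be the nondecreasing Hechler forcing: conditions are pairs $\langle s,f\rangle$ with $s\in\omega^{<\omega}$ monotonically nondecreasing and $f\in\omega^\omega$, and $\langle s',f'\rangle\le\langle s,f\rangle$ iff $s\subseteq s'$, $f(n)\le f'(n)$ for all $n$, and $f(n)\le s'(n)$ for all $n\in|s'|\setminus|s|$. Let $d\in\omega^\omega$ be $\mathbb{D}_{nd}$-generic over $V$ ($d$ is the union of the stems $s$ of the conditions in the generic filter). For reals write $x\le^* y$ if $x(n)\le y(n)$ for all but finitely many $n$, and let $\mathcal{D}$ be the set of dominating reals of $V[d]$, i.e. of those $y\in V[d]\cap\omega^\omega$ with $f\le^* y$ for every $f\in V\cap\omega^\omega$. Let $\omega^{\nearrow\omega}$ be the set of nondecreasing functions from $\omega$ to $\omega$ which tend to infinity. Two preorders are called cofinally isomorphic if they have isomorphic cofinal subsets. Then, in $V[d]$, the structures $(V\cap\omega^\omega,\le^*)$ and $(\mathcal{D},{}^*\!\!\ge)$ are cofinally isomorphic. More precisely: (a) There are, in $V$, a set $C\subseteq\omega^\omega$ cofinal in $(\omega^\omega,\le^*)$ and a map $z\mapsto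 z'$ from $C$ to $\omega^{\nearrow\omega}$ such that $z_0\le^* z_1\Leftrightarrow z_1'\le^* z_0'$ for all $z_0,z_1\in C$, such that every $w\in\omega^{\nearrow\omega}$ satisfies $z'\le^* w$ for some $z\in C$, and such that, in $V[d]$, the map $z\mapsto z'\circ d\circ z'$ is an isomorphism from $(C,\le^*)$, a cofinal subset of $(V\cap\omega^\omega,\le^*)$, onto a cofinal subset of $(\mathcal{D},{}^*\!\!\ge)$. (b) For $z\in V\cap\omega^{\nearrow\omega}$ the real $z\circ d\circ z$ is dominating; for $z_0,z_1\in V\cap\omega^{\nearrow\omega}$ we have $z_0\le^* z_1\Leftrightarrow z_0\circ d\circ z_0\le^* z_1\circ d\circ z_1$; and for every $y\in\mathcal{D}$ there is $z\in V\cap\omega^{\nearrow\omega}$ with $z\circ d\circ z\le^* y$. -/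

import Mathlib

/-! ### Reals of the ground model -/

/-- Eventual domination `f ≤* g` on `ω^ω`. -/
def EvLE (f g : ℕ → ℕ) : Prop := ∃ N, ∀ n, N ≤ n → f n ≤ g n

/-- The nondecreasing functions which tend to infinity. -/
def NondecToInfty (z : ℕ → ℕ) : Prop :=
  Monotone z ∧ Filter.Tendsto z Filter.atTop Filter.atTop

/-! ### The forcing relation

The ground model `V` is the ambient universe and `P` is a notion of forcing (`q ≤ p` means that
`q` is stronger). A sentence of the forcing language is represented by the set of conditions that
force it; the connectives are the clauses of the definition of the forcing relation. A statement
holds in every generic extension `V[G]` exactly if every condition forces it. -/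

/-- A sentence of the forcing language: `φ p` reads `p ⊩ φ`. -/
def Sentence (P : Type) : Type := P → Prop

namespace Sentence

/-- A statement about the ground model only. -/
def ofProp {P : Type} (a : Prop) : Sentence P := fun _ => a

def and {P : Type} (φ ψ : Sentence P) : Sentence P := fun p => φ p ∧ ψ p

def imp {P : Type} [Preorder P] (φ ψ : Sentence P) : Sentence P :=
  fun p => ∀ q, q ≤ p → φ q → ψ q

def iff {P : Type} [Preorder P] (φ ψ : Sentence P) : Sentence P :=
  and (imp φ ψ) (imp ψ φ)

def all {P : Type} {ι : Type} (φ : ι → Sentence P) : Sentence P := fun p => ∀ i, φ i p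

/-- `p ⊩ ∃ i, φ i` iff the conditions forcing some instance are dense below `p`. -/
def ex {P : Type} [Preorder P] {ι : Type} (φ : ι → Sentence P) : Sentence P :=
  fun p => ∀ q, q ≤ p → ∃ r, r ≤ q ∧ ∃ i, φ i r

/-- `⊩ φ`: every condition forces `φ`. -/
def Forced {P : Type} (φ : Sentence P) : Prop := ∀ p, φ p

end Sentence

/-! ### Names for reals -/

/-- A (nice) name for a real, that is the name `{(⟨n, i⟩ˇ, t) : t ∈ val n i}` for a set of pairs
which is forced to be a function from `ω` to `ω`. Every real of `V[G]` has such a name. -/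
structure RealName (P : Type) [Preorder P] where
  val : ℕ → ℕ → Set P
  functional : ∀ n i j t u r, t ∈ val n i → u ∈ val n j → r ≤ t → r ≤ u → i = j
  total : ∀ n p, ∃ q, q ≤ p ∧ ∃ i, ∃ t ∈ val n i, q ≤ t

namespace RealName

open Sentence

/-- The sentence `x(n) = i`. It is forced by `p` iff the conditions below a member of `val n i`
are dense below `p`. -/
def app {P : Type} [Preorder P] (x : RealName P) (n i : ℕ) : Sentence P :=
  fun p => ∀ q, q ≤ p → ∃ r, r ≤ q ∧ ∃ t ∈ x.val n i, r ≤ t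

theorem app_mono {P : Type} [Preorder P] (x : RealName P) {n i : ℕ} {p q : P} (h : q ≤ p)
    (hp : x.app n i p) : x.app n i q := fun r hr => hp r (hr.trans h)

theorem app_of_le {P : Type} [Preorder P] (x : RealName P) {n i : ℕ} {p t : P}
    (ht : t ∈ x.val n i) (h : p ≤ t) : x.app n i p :=
  fun q hq => ⟨q, le_rfl, t, ht, hq.trans h⟩

theorem app_unique {P : Type} [Preorder P] (x : RealName P) {n i j : ℕ} {p : P}
    (hi : x.app n i p) (hj : x.app n j p) : i = j := by
  obtain ⟨r, hr, t, ht, hrt⟩ := hi p le_rfl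
  obtain ⟨r', hr', t', ht', hrt'⟩ := hj r hr
  exact x.functional n i j t t' r' ht ht' (hr'.trans hrt) hrt'

/-- The canonical name of a real of the ground model. -/
def check {P : Type} [Preorder P] (z : ℕ → ℕ) : RealName P where
  val n i := {_t | z n = i}
  functional _ _ _ _ _ _ ht hu _ _ := ht.symm.trans hu
  total n p := ⟨p, le_rfl, z n, p, rfl, le_rfl⟩

/-- A name for the composition `x ∘ y`. -/
def comp {P : Type} [Preorder P] (x y : RealName P) : RealName P where
  val n i := {t | ∃ k, y.app n k t ∧ x.app k i t}
  functional := by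
    rintro n i j t u r ⟨k, h1, h2⟩ ⟨l, h3, h4⟩ hrt hru
    obtain rfl := y.app_unique (y.app_mono hrt h1) (y.app_mono hru h3)
    exact x.app_unique (x.app_mono hrt h2) (x.app_mono hru h4)
  total := by
    intro n p
    obtain ⟨q, hq, k, t, ht, hqt⟩ := y.total n p
    obtain ⟨r, hr, i, u, hu, hru⟩ := x.total k q
    exact ⟨r, hr.trans hq, i, r,
      ⟨k, y.app_of_le ht (hr.trans hqt), x.app_of_le hu hru⟩, le_rfl⟩

/-- The sentence `x = y`. -/
def eq {P : Type} [Preorder P] (x y : RealName P) : Sentence P :=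
  all fun n : ℕ => all fun i : ℕ => iff (x.app n i) (y.app n i)

/-- The sentence `x ≤* y`. -/
def leStar {P : Type} [Preorder P] (x y : RealName P) : Sentence P :=
  ex fun N : ℕ => all fun n : ℕ => all fun i : ℕ => all fun j : ℕ =>
    imp (x.app n i) (imp (y.app n j) (ofProp (N ≤ n → i ≤ j)))

/-- The sentence `x ∈ V`. -/
def inGround {P : Type} [Preorder P] (x : RealName P) : Sentence P :=
  ex fun z : ℕ → ℕ => eq x (check z)

/-- The sentence `y is a dominating real`: it eventually dominates all reals of `V`. -/
def dominating {P : Type} [Preorder P] (y : RealName P) : Sentence P :=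
  all fun f : ℕ → ℕ => leStar (check f) y

theorem eq_mono {P : Type} [Preorder P] {x y : RealName P} {p q : P} (h : q ≤ p)
    (hp : eq x y p) : eq x y q :=
  fun n i => ⟨fun r hr => (hp n i).1 r (hr.trans h), fun r hr => (hp n i).2 r (hr.trans h)⟩

theorem eq_symm_trans {P : Type} [Preorder P] {x y z : RealName P} {p : P}
    (h : eq x y p) (h' : eq x z p) : eq y z p :=
  fun n i => ⟨fun r hr hy => (h' n i).1 r hr ((h n i).2 r hr hy),
    fun r hr hz => (h n i).1 r hr ((h' n i).2 r hr hz)⟩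

end RealName

/-! ### Binary relations on the reals of the extension and cofinal isomorphism -/

/-- A name for a binary relation on the reals of `V[G]`: its value at two names is the set of
conditions forcing them to be related. -/
structure RelName (P : Type) [Preorder P] where
  mem : RealName P → RealName P → Sentence P
  regular : ∀ x y p, mem x y p ↔ ∀ q, q ≤ p → ∃ r, r ≤ q ∧ mem x y r
  ext : ∀ x y x' y' p, RealName.eq x x' p → RealName.eq y y' p → mem x y p → mem x' y' p

open Sentence in
/-- The sentence: `F` is an isomorphism from a cofinal subset of the preorder `(A, leA)` onto a
cofinal subset of the preorder `(B, leB)`. The clauses say that `F ⊆ A × B`, that `F` is an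
injective function on its domain, that it preserves and reflects the order, that its domain is
cofinal in `A`, and that its range is cofinal in `B`. -/
def isCofinalIso {P : Type} [Preorder P] (F : RelName P)
    (A : RealName P → Sentence P) (leA : RealName P → RealName P → Sentence P)
    (B : RealName P → Sentence P) (leB : RealName P → RealName P → Sentence P) : Sentence P :=
  and (all fun x => all fun y => imp (F.mem x y) (and (A x) (B y))) <|
  and (all fun x => all fun y => all fun x' => all fun y' =>
    imp (F.mem x y) (imp (F.mem x' y') (iff (RealName.eq x x') (RealName.eq y y')))) <|
  and (all fun x => all fun y => all fun x' => all fun y' =>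
    imp (F.mem x y) (imp (F.mem x' y') (iff (leA x x') (leB y y')))) <|
  and (all fun a => imp (A a) (ex fun x => ex fun y => and (F.mem x y) (leA a x)))
    (all fun b => imp (B b) (ex fun x => ex fun y => and (F.mem x y) (leB b y)))

/-- The sentence: `(A, leA)` and `(B, leB)` are cofinally isomorphic, that is, they have
isomorphic cofinal subsets. -/
def cofinallyIsomorphic {P : Type} [Preorder P]
    (A : RealName P → Sentence P) (leA : RealName P → RealName P → Sentence P)
    (B : RealName P → Sentence P) (leB : RealName P → RealName P → Sentence P) : Sentence P :=
  Sentence.ex fun F : RelName P => isCofinalIso F A leA B leB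

/-! ### Nondecreasing Hechler forcing -/

/-- A condition `⟨s, f⟩`: a nondecreasing finite sequence and a real. -/
structure Dnd where
  stem : List ℕ
  nondec : stem.Pairwise (· ≤ ·)
  commit : ℕ → ℕ

namespace Dnd

theorem prefix_getElem? {s t : List ℕ} (h : s <+: t) {n i : ℕ} (hs : s[n]? = some i) :
    t[n]? = some i := by
  obtain ⟨u, rfl⟩ := h
  have hn : n < s.length := by
    by_contra hc
    rw [List.getElem?_eq_none (not_lt.1 hc)] at hs
    cases hs
  rw [List.getElem?_append_left hn, hs]

/-- `⟨s', f'⟩ ≤ ⟨s, f⟩` iff `s ⊆ s'`, `f ≤ f'` everywhere, and `f(n) ≤ s'(n)` for all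
`n ∈ |s'| \ |s|`. -/
instance : Preorder Dnd where
  le q p := p.stem <+: q.stem ∧ (∀ n, p.commit n ≤ q.commit n) ∧
    ∀ n i, p.stem.length ≤ n → q.stem[n]? = some i → p.commit n ≤ i
  le_refl p := ⟨List.prefix_refl _, fun _ => le_rfl, fun n i hn h => by
    rw [List.getElem?_eq_none hn] at h
    cases h⟩
  le_trans := by
    rintro r q p ⟨h1, h2, h3⟩ ⟨k1, k2, k3⟩
    refine ⟨k1.trans h1, fun n => (k2 n).trans (h2 n), fun n i hn hi => ?_⟩
    by_cases hq : q.stem.length ≤ n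
    · exact (k2 n).trans (h3 n i hq hi)
    · have hlt : n < q.stem.length := not_le.1 hq
      have hj : q.stem[n]? = some q.stem[n] := List.getElem?_eq_getElem hlt
      have := prefix_getElem? h1 hj
      rw [hi] at this
      cases this
      exact k3 n _ hn hj

theorem exists_longer (p : Dnd) : ∃ q, q ≤ p ∧ q.stem.length = p.stem.length + 1 := by
  have hb : ∀ s : List ℕ, ∃ b, ∀ a ∈ s, a ≤ b := by
    intro s
    exact ⟨s.sum, fun a ha => List.single_le_sum (fun _ _ => Nat.zero_le _) a ha⟩
  obtain ⟨b, hb⟩ := hb p.stem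
  let v := max b (p.commit p.stem.length)
  refine ⟨⟨p.stem ++ [v], ?_, p.commit⟩, ⟨List.prefix_append _ _, fun _ => le_rfl, ?_⟩, by simp⟩
  · rw [List.pairwise_append]
    refine ⟨p.nondec, List.pairwise_singleton _ _, fun a ha c hc => ?_⟩
    rw [List.mem_singleton] at hc
    subst hc
    exact (hb a ha).trans (le_max_left _ _)
  · intro n i hn hi
    rcases hn.eq_or_lt with h | h
    · subst h
      have : v = i := by simpa using hi
      subst this
      exact le_max_right _ _
    · have hnone : (p.stem ++ [v])[n]? = none :=
        List.getElem?_eq_none (by simpa using h)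
      change (p.stem ++ [v])[n]? = some i at hi
      rw [hnone] at hi
      cases hi

theorem exists_length_gt (p : Dnd) (n : ℕ) : ∃ q, q ≤ p ∧ n < q.stem.length := by
  induction n with
  | zero =>
    obtain ⟨q, hq, hl⟩ := p.exists_longer
    exact ⟨q, hq, by omega⟩
  | succ n ih =>
    obtain ⟨q, hq, hl⟩ := ih
    obtain ⟨r, hr, hl'⟩ := q.exists_longer
    exact ⟨r, hr.trans hq, by omega⟩

/-- The name of the generic real `d`, the union of the stems of the conditions in the generic
filter. -/
def d : RealName Dnd where
  val n i := {t | t.stem[n]? = some i}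
  functional := by
    intro n i j t u r ht hu hrt hru
    have h1 := prefix_getElem? hrt.1 ht
    have h2 := prefix_getElem? hru.1 hu
    rw [h1] at h2
    exact Option.some.inj h2
  total := by
    intro n p
    obtain ⟨q, hq, hl⟩ := p.exists_length_gt n
    exact ⟨q, hq, q.stem[n], q, List.getElem?_eq_getElem hl, le_rfl⟩

/-- The name of `z ∘ d ∘ z`. -/
def sandwich (z : ℕ → ℕ) : RealName Dnd :=
  (RealName.check z).comp (d.comp (RealName.check z))

open Sentence in
/-- The name of the map `z ↦ ρ z ∘ d ∘ ρ z` with domain `C`, where `C` and `ρ` are in `V`. -/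
def sandwichMap (C : Set (ℕ → ℕ)) (ρ : (ℕ → ℕ) → (ℕ → ℕ)) : RelName Dnd where
  mem x y := ex fun z : C =>
    and (RealName.eq x (RealName.check z.1)) (RealName.eq y (sandwich (ρ z.1)))
  regular := by
    intro x y p
    constructor
    · intro h q hq
      exact ⟨q, le_rfl, fun r hr => h r (hr.trans hq)⟩
    · intro h q hq
      obtain ⟨r, hr, h'⟩ := h q hq
      obtain ⟨s, hs, h''⟩ := h' r le_rfl
      exact ⟨s, hs.trans hr, h''⟩
  ext := by
    intro x y x' y' p hx hy h q hq
    obtain ⟨r, hr, z, h1, h2⟩ := h q hq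
    exact ⟨r, hr, z, RealName.eq_symm_trans (RealName.eq_mono (hr.trans hq) hx) h1,
      RealName.eq_symm_trans (RealName.eq_mono (hr.trans hq) hy) h2⟩

end Dnd

/-! ### Nondecreasing functions tending to infinity -/

namespace EvLE

/-! The generalized inverse is an involution on the nondecreasing functions tending to infinity and
reverses `≤*` (`evLE_genInv_iff`). These functions are cofinal in `ω^ω`, so it remains to show that
`z ↦ z ∘ d ∘ z` embeds them, ordered by `≤*`, coinitially into the dominating reals.

The map preserves `≤*` because `d` is nondecreasing. It reflects `≤*` because, when `w n < z n`, a
condition can decide `d (w n)` and still push `d (z n)` arbitrarily high.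

Coinitiality (`exists_sandwich_leStar`) is a rank argument for a name `y` of a dominating real. If
stems of bounded length with arbitrarily large new values favored bounds on `y n` for arbitrarily
large `n`, then a ground model real beating these countably many bounds would not be dominated by
`y`. Hence, below some condition, stems of length at most `k` favor no bound on `y n` once `n` is
large. By compactness (`exists_uniform_bound`), one commitment then forces `y n > i` over all these
stems at once. A real `z` growing slowly enough makes the actual generic `d` satisfy the commitment
belonging to `i = z₂ (d (z₁ n))`, where `z = min z₁ z₂`; so `y n` exceeds `z (d (z n))`. -/

theorem refl (f : ℕ → ℕ) : EvLE f f := ⟨0, fun _ _ => le_rfl⟩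

theorem trans {f g h : ℕ → ℕ} (h₁ : EvLE f g) (h₂ : EvLE g h) : EvLE f h := by
  obtain ⟨M, hM⟩ := h₁
  obtain ⟨N, hN⟩ := h₂
  exact ⟨max M N, fun n hn => (hM n ((le_max_left _ _).trans hn)).trans
    (hN n ((le_max_right _ _).trans hn))⟩

end EvLE

namespace NondecToInfty

theorem exists_ge {z : ℕ → ℕ} (hz : NondecToInfty z) (m : ℕ) : ∃ N, ∀ n, N ≤ n → m ≤ z n :=
  Filter.eventually_atTop.1 (hz.2.eventually_ge_atTop m)

theorem of_monotone {z : ℕ → ℕ} (hz : Monotone z) (h : ∀ m, ∃ n, m ≤ z n) : NondecToInfty z :=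
  ⟨hz, Filter.tendsto_atTop_atTop_of_monotone hz h⟩

theorem min {z w : ℕ → ℕ} (hz : NondecToInfty z) (hw : NondecToInfty w) :
    NondecToInfty fun n => min (z n) (w n) := by
  refine of_monotone (fun a b h => min_le_min (hz.1 h) (hw.1 h)) fun m => ?_
  obtain ⟨M, hM⟩ := hz.exists_ge m
  obtain ⟨N, hN⟩ := hw.exists_ge m
  exact ⟨max M N, le_min (hM _ (le_max_left _ _)) (hN _ (le_max_right _ _))⟩

/-- The nondecreasing functions tending to infinity are cofinal. -/
theorem exists_le (f : ℕ → ℕ) : ∃ z, NondecToInfty z ∧ ∀ n, f n ≤ z n := by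
  refine ⟨fun n => n + ∑ k ∈ Finset.range (n + 1), f k,
    of_monotone (fun a b h => ?_) fun m => ⟨m, Nat.le_add_right _ _⟩, fun n => ?_⟩
  · exact add_le_add h (Finset.sum_le_sum_of_subset (by simpa using h))
  · exact (Finset.single_le_sum (f := f) (fun _ _ => Nat.zero_le _)
      (Finset.mem_range.2 n.lt_succ_self)).trans (Nat.le_add_left _ _)

end NondecToInfty

open Classical in
/-- The generalized inverse `m ↦ |{n : z n ≤ m}|`. -/
noncomputable def genInv (z : ℕ → ℕ) (m : ℕ) : ℕ :=
  if h : ∃ n, m < z n then Nat.find h else 0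

namespace NondecToInfty

/-- This adjunction is the only property of `genInv` used later; the default value 0 never occurs
for unbounded `z`. -/
theorem lt_genInv {z : ℕ → ℕ} (hz : NondecToInfty z) (n m : ℕ) : n < genInv z m ↔ z n ≤ m := by
  classical
  obtain ⟨N, hN⟩ := hz.exists_ge (m + 1)
  have h : ∃ n, m < z n := ⟨N, hN N le_rfl⟩
  rw [genInv, dif_pos h, Nat.lt_find_iff]
  exact ⟨fun h => not_lt.1 (h n le_rfl), fun h k hk => not_lt.2 ((hz.1 hk).trans h)⟩

theorem genInv {z : ℕ → ℕ} (hz : NondecToInfty z) : NondecToInfty (genInv z) := by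
  refine of_monotone (fun a b hab => ?_) fun m => ⟨z m, ((hz.lt_genInv m _).2 le_rfl).le⟩
  by_contra! h
  exact lt_irrefl _ ((hz.lt_genInv _ _).2 (((hz.lt_genInv _ _).1 h).trans hab))

theorem genInv_genInv {z : ℕ → ℕ} (hz : NondecToInfty z) : _root_.genInv (_root_.genInv z) = z := by
  funext n
  refine eq_of_forall_lt_iff fun m => ?_
  rw [hz.genInv.lt_genInv, ← not_lt, hz.lt_genInv, not_le]

theorem evLE_genInv {z w : ℕ → ℕ} (hz : NondecToInfty z) (hw : NondecToInfty w)
    (h : EvLE z w) : EvLE (_root_.genInv w) (_root_.genInv z) := by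
  obtain ⟨N, hN⟩ := h
  obtain ⟨M, hM⟩ := hz.genInv.exists_ge N
  refine ⟨M, fun m hm => ?_⟩
  by_contra! hlt
  have h1 := (hw.lt_genInv _ _).1 hlt
  exact lt_irrefl _ ((hz.lt_genInv _ _).2 ((hN _ (hM m hm)).trans h1))

theorem evLE_genInv_iff {z w : ℕ → ℕ} (hz : NondecToInfty z) (hw : NondecToInfty w) :
    EvLE z w ↔ EvLE (_root_.genInv w) (_root_.genInv z) := by
  refine ⟨hz.evLE_genInv hw, fun h => ?_⟩
  have := hw.genInv.evLE_genInv hz.genInv h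
  rwa [hz.genInv_genInv, hw.genInv_genInv] at this

/-- Every function has an eventual lower inverse among the nondecreasing functions tending to
infinity. -/
theorem exists_apply_le (f : ℕ → ℕ) :
    ∃ z, NondecToInfty z ∧ ∃ N, ∀ n, N ≤ n → f (z n) ≤ n := by
  -- The shift by one matches the strict inequality in `lt_genInv`: if the inverse of `w` at `n` is
  -- `k + 1`, then `w k ≤ n`.
  obtain ⟨w, hw, hfw⟩ := exists_le fun n => f (n + 1)
  obtain ⟨N, hN⟩ := hw.genInv.exists_ge 1
  refine ⟨_root_.genInv w, hw.genInv, N, fun n hn => ?_⟩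
  obtain ⟨k, hk⟩ := Nat.exists_eq_add_of_le' (hN n hn)
  rw [hk]
  exact (hfw k).trans ((hw.lt_genInv _ _).1 (by omega))

end NondecToInfty

/-- Eventual equality of nondecreasing functions tending to infinity. -/
def evEqSetoid : Setoid {z : ℕ → ℕ // NondecToInfty z} where
  r z w := EvLE z.1 w.1 ∧ EvLE w.1 z.1
  iseqv := ⟨fun _ => ⟨EvLE.refl _, EvLE.refl _⟩, fun h => ⟨h.2, h.1⟩,
    fun h k => ⟨h.1.trans k.1, k.2.trans h.2⟩⟩

/-- A set of representatives of the nondecreasing functions tending to infinity modulo eventual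
equality. -/
def nondecReps : Set (ℕ → ℕ) := Set.range fun c : Quotient evEqSetoid => c.out.1

theorem nondecToInfty_of_mem_nondecReps {z : ℕ → ℕ} (hz : z ∈ nondecReps) : NondecToInfty z := by
  obtain ⟨c, rfl⟩ := hz
  exact c.out.2

theorem exists_mem_nondecReps {z : ℕ → ℕ} (hz : NondecToInfty z) :
    ∃ w ∈ nondecReps, EvLE w z ∧ EvLE z w :=
  ⟨_, ⟨Quotient.mk evEqSetoid ⟨z, hz⟩, rfl⟩, Quotient.exact (s := evEqSetoid) (Quotient.out_eq _)⟩

theorem eq_of_mem_nondecReps {z w : ℕ → ℕ} (hz : z ∈ nondecReps) (hw : w ∈ nondecReps)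
    (h : EvLE z w) (h' : EvLE w z) : z = w := by
  obtain ⟨c, rfl⟩ := hz
  obtain ⟨e, rfl⟩ := hw
  have : c = e := by
    rw [← c.out_eq, ← e.out_eq]
    exact Quotient.sound (s := evEqSetoid) ⟨h, h'⟩
  rw [this]

/-- A countable family of functions is simultaneously dominated. -/
theorem exists_forall_lt_of_countable {α : Type} [Countable α] (G : α → ℕ → ℕ) :
    ∃ g : ℕ → ℕ, ∀ a, ∃ N₀, ∀ N, N₀ ≤ N → ∀ n, N ≤ n → G a N < g n := by
  rcases isEmpty_or_nonempty α with _ | _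
  · exact ⟨0, fun a => isEmptyElim a⟩
  obtain ⟨e, he⟩ := exists_surjective_nat α
  -- Diagonal bound: `g n` exceeds every `G (e k) N` with `k, N ≤ n`, so it beats the value at `N`
  -- at all later arguments too.
  refine ⟨fun n => ((Finset.range (n + 1)) ×ˢ (Finset.range (n + 1))).sup
    (fun x => G (e x.1) x.2) + 1, fun a => ?_⟩
  obtain ⟨k, rfl⟩ := he a
  refine ⟨k, fun N hN n hn => Nat.lt_succ_of_le ?_⟩
  exact Finset.le_sup (f := fun x : ℕ × ℕ => G (e x.1) x.2) (b := (k, N))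
    (by simp only [Finset.mem_product, Finset.mem_range]; omega)

/-! ### Sentences about names for reals -/

namespace RealName

variable {P : Type} [Preorder P]

theorem exists_app (x : RealName P) (n : ℕ) (p : P) : ∃ q, q ≤ p ∧ ∃ i, x.app n i q := by
  obtain ⟨q, hq, i, t, ht, hqt⟩ := x.total n p
  exact ⟨q, hq, i, x.app_of_le ht hqt⟩

theorem app_of_dense {x : RealName P} {n i : ℕ} {p : P}
    (h : ∀ q, q ≤ p → ∃ r, r ≤ q ∧ x.app n i r) : x.app n i p := by
  intro q hq
  obtain ⟨r, hr, h'⟩ := h q hq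
  obtain ⟨s, hs, h''⟩ := h' r le_rfl
  exact ⟨s, hs.trans hr, h''⟩

theorem check_app (z : ℕ → ℕ) (n : ℕ) (p : P) : (check z).app n (z n) p :=
  app_of_le _ (t := p) rfl le_rfl

theorem eq_refl (x : RealName P) (p : P) : eq x x p :=
  fun _ _ => ⟨fun _ _ h => h, fun _ _ h => h⟩

theorem eq_symm {x y : RealName P} {p : P} (h : eq x y p) : eq y x p :=
  fun n i => ⟨(h n i).2, (h n i).1⟩

theorem eq_trans {x y w : RealName P} {p : P} (h : eq x y p) (h' : eq y w p) : eq x w p :=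
  eq_symm_trans (eq_symm h) h'

theorem eq_of_dense {x y : RealName P} {p : P}
    (h : ∀ q, q ≤ p → ∃ r, r ≤ q ∧ eq x y r) : eq x y p := by
  refine fun n i => ⟨fun q hq hx => app_of_dense fun r hr => ?_,
    fun q hq hx => app_of_dense fun r hr => ?_⟩
  · obtain ⟨s, hs, he⟩ := h r (hr.trans hq)
    exact ⟨s, hs, (he n i).1 s le_rfl (app_mono _ (hs.trans hr) hx)⟩
  · obtain ⟨s, hs, he⟩ := h r (hr.trans hq)
    exact ⟨s, hs, (he n i).2 s le_rfl (app_mono _ (hs.trans hr) hx)⟩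

theorem leStar_mono {x y : RealName P} {p q : P} (h : q ≤ p) (hp : leStar x y p) :
    leStar x y q := fun r hr => hp r (hr.trans h)

theorem leStar_of_dense {x y : RealName P} {p : P}
    (h : ∀ q, q ≤ p → ∃ r, r ≤ q ∧ leStar x y r) : leStar x y p := by
  intro q hq
  obtain ⟨r, hr, h'⟩ := h q hq
  obtain ⟨s, hs, h''⟩ := h' r le_rfl
  exact ⟨s, hs.trans hr, h''⟩

/-- To force `x ≤* y` it suffices to compare the values that a dense set of conditions decides. -/
theorem leStar_of_forall {x y : RealName P} {p : P}
    (h : ∀ q, q ≤ p → ∃ r, r ≤ q ∧ ∃ N, ∀ n, N ≤ n → ∀ t, t ≤ r →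
      ∃ u, u ≤ t ∧ ∃ i j, x.app n i u ∧ y.app n j u ∧ i ≤ j) : leStar x y p := by
  intro q hq
  obtain ⟨r, hr, N, hN⟩ := h q hq
  refine ⟨r, hr, N, fun n i j s hs hi t ht hj hn => ?_⟩
  obtain ⟨u, hu, i', j', hi', hj', hij⟩ := hN n hn t (ht.trans hs)
  rwa [x.app_unique (x.app_mono (hu.trans ht) hi) hi', y.app_unique (y.app_mono hu hj) hj']

theorem exists_of_leStar {x y : RealName P} {p : P} (h : leStar x y p) :
    ∃ q, q ≤ p ∧ ∃ N, ∀ n, N ≤ n → ∀ r, r ≤ q → ∀ i j, x.app n i r → y.app n j r → i ≤ j := by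
  obtain ⟨q, hq, N, hN⟩ := h p le_rfl
  exact ⟨q, hq, N, fun n hn r hr i j hi hj => hN n i j r hr hi r le_rfl hj hn⟩

theorem leStar_trans {x y w : RealName P} {p : P} (h : leStar x y p) (h' : leStar y w p) :
    leStar x w p := by
  refine leStar_of_forall fun q hq => ?_
  obtain ⟨r, hr, M, hM⟩ := exists_of_leStar (leStar_mono hq h)
  obtain ⟨s, hs, N, hN⟩ := exists_of_leStar (leStar_mono (hr.trans hq) h')
  refine ⟨s, hs.trans hr, max M N, fun n hn t ht => ?_⟩
  obtain ⟨t₁, ht₁, i, hi⟩ := x.exists_app n t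
  obtain ⟨t₂, ht₂, j, hj⟩ := y.exists_app n t₁
  obtain ⟨t₃, ht₃, k, hk⟩ := w.exists_app n t₂
  have hi' := x.app_mono (ht₃.trans ht₂) hi
  have hj' := y.app_mono ht₃ hj
  have ht' : t₃ ≤ s := ((ht₃.trans ht₂).trans ht₁).trans ht
  exact ⟨t₃, (ht₃.trans ht₂).trans ht₁, i, k, hi', hk,
    (hM n ((le_max_left _ _).trans hn) t₃ (ht'.trans hs) i j hi' hj').trans
      (hN n ((le_max_right _ _).trans hn) t₃ ht' j k hj' hk)⟩

theorem leStar_of_eq {x y : RealName P} {p : P} (h : eq x y p) : leStar x y p := by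
  refine leStar_of_forall fun q hq => ⟨q, le_rfl, 0, fun n _ t ht => ?_⟩
  obtain ⟨u, hu, i, hi⟩ := x.exists_app n t
  exact ⟨u, hu, i, i, hi, (h n i).1 u ((hu.trans ht).trans hq) hi, le_rfl⟩

theorem leStar_congr {x y x' y' : RealName P} {p : P} (hx : eq x x' p) (hy : eq y y' p) :
    leStar x y p ↔ leStar x' y' p :=
  ⟨fun h => leStar_trans (leStar_of_eq (eq_symm hx)) (leStar_trans h (leStar_of_eq hy)),
    fun h => leStar_trans (leStar_of_eq hx) (leStar_trans h (leStar_of_eq (eq_symm hy)))⟩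

theorem leStar_check {z w : ℕ → ℕ} (h : EvLE z w) (p : P) : leStar (check z) (check w) p := by
  obtain ⟨N, hN⟩ := h
  exact leStar_of_forall fun q _ => ⟨q, le_rfl, N, fun n hn t _ =>
    ⟨t, le_rfl, _, _, check_app z n t, check_app w n t, hN n hn⟩⟩

theorem evLE_of_leStar_check {z w : ℕ → ℕ} {p : P} (h : leStar (check z) (check w) p) :
    EvLE z w := by
  obtain ⟨q, _, N, hN⟩ := exists_of_leStar h
  exact ⟨N, fun n hn => hN n hn q le_rfl _ _ (check_app z n q) (check_app w n q)⟩

theorem eq_of_eq_check {z w : ℕ → ℕ} {p : P} (h : eq (check z) (check w) p) : z = w := by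
  funext n
  exact app_unique _ ((h n (z n)).1 p le_rfl (check_app z n p)) (check_app w n p)

end RealName

theorem RelName.mem_mono {P : Type} [Preorder P] (F : RelName P) {x y : RealName P} {p q : P}
    (h : q ≤ p) (hp : F.mem x y p) : F.mem x y q :=
  (F.regular x y q).2 fun r hr => (F.regular x y p).1 hp r (hr.trans h)

/-! ### Extending conditions -/

namespace Dnd

theorem stem_mono (p : Dnd) {m n a b : ℕ} (h : m ≤ n) (ha : p.stem[m]? = some a)
    (hb : p.stem[n]? = some b) : a ≤ b := by
  obtain ⟨hm, rfl⟩ := List.getElem?_eq_some_iff.1 ha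
  obtain ⟨hn, rfl⟩ := List.getElem?_eq_some_iff.1 hb
  rcases h.eq_or_lt with rfl | h
  · exact le_rfl
  · exact List.pairwise_iff_getElem.1 p.nondec m n hm hn h

theorem exists_length_eq (p : Dnd) {n : ℕ} (hn : p.stem.length ≤ n) :
    ∃ q, q ≤ p ∧ q.stem.length = n := by
  induction n, hn using Nat.le_induction with
  | base => exact ⟨p, le_rfl, rfl⟩
  | succ n _ ih =>
    obtain ⟨q, hq, hl⟩ := ih
    obtain ⟨r, hr, hl'⟩ := q.exists_longer
    exact ⟨r, hr.trans hq, by omega⟩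

theorem exists_getElem? (p : Dnd) (n : ℕ) : ∃ q, q ≤ p ∧ ∃ a, q.stem[n]? = some a := by
  obtain ⟨q, hq, hl⟩ := p.exists_length_gt n
  exact ⟨q, hq, _, List.getElem?_eq_getElem hl⟩

/-- Strengthening of a condition by a further commitment. -/
def commitTo (p : Dnd) (g : ℕ → ℕ) : Dnd := ⟨p.stem, p.nondec, p.commit ⊔ g⟩

theorem commitTo_le (p : Dnd) (g : ℕ → ℕ) : p.commitTo g ≤ p :=
  ⟨List.prefix_refl _, fun _ => le_sup_left, fun n i hn h => by
    rw [show (p.commitTo g).stem = p.stem from rfl, List.getElem?_eq_none hn] at h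
    cases h⟩

theorem le_of_le_commitTo {p q : Dnd} {g : ℕ → ℕ} (h : q ≤ p.commitTo g) {n a : ℕ}
    (hn : p.stem.length ≤ n) (ha : q.stem[n]? = some a) : g n ≤ a :=
  le_sup_right.trans (h.2.2 n a hn ha)

/-! ### The reals `z ∘ d ∘ z` -/

theorem sandwich_app {z : ℕ → ℕ} {p : Dnd} {n a : ℕ} (h : p.stem[z n]? = some a) :
    (sandwich z).app n (z a) p :=
  RealName.app_of_le _ (t := p)
    ⟨a, RealName.app_of_le _ (t := p) ⟨z n, RealName.check_app z n p,
      RealName.app_of_le _ (t := p) h le_rfl⟩ le_rfl, RealName.check_app z a p⟩ le_rfl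

theorem dominating_sandwich {z : ℕ → ℕ} (hz : NondecToInfty z) (p : Dnd) :
    RealName.dominating (sandwich z) p := by
  intro f
  have hg : ∀ m, ∃ l, ∀ n, z n ≤ m → f n ≤ z l := by
    intro m
    obtain ⟨B, hB⟩ := hz.exists_ge (m + 1)
    obtain ⟨l, hl⟩ := hz.exists_ge ((Finset.range B).sup f)
    -- Only finitely many `n` satisfy `z n ≤ m`, so one value of `z` bounds `f` on all of them.
    -- Committing `d` to `g` then gives `f n ≤ z (d (z n))`.
    refine ⟨l, fun n hn => (Finset.le_sup (Finset.mem_range.2 ?_)).trans (hl l le_rfl)⟩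
    by_contra! h
    exact absurd (hB n h) (by omega)
  choose g hg using hg
  refine RealName.leStar_of_forall fun q _ => ?_
  obtain ⟨N, hN⟩ := hz.exists_ge q.stem.length
  refine ⟨q.commitTo g, q.commitTo_le g, N, fun n hn t ht => ?_⟩
  obtain ⟨u, hu, a, ha⟩ := t.exists_getElem? (z n)
  exact ⟨u, hu, _, _, RealName.check_app f n u, sandwich_app ha,
    (hg (z n) n le_rfl).trans (hz.1 (le_of_le_commitTo (hu.trans ht) (hN n hn) ha))⟩

theorem leStar_sandwich {z w : ℕ → ℕ} (hz : NondecToInfty z) (h : EvLE z w) (p : Dnd) :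
    RealName.leStar (sandwich z) (sandwich w) p := by
  obtain ⟨M, hM⟩ := h
  refine RealName.leStar_of_forall fun q _ => ?_
  obtain ⟨N, hN⟩ := hz.exists_ge q.stem.length
  -- The chain is `z (d (z n)) ≤ z (d (w n)) ≤ w (d (w n))`; the commitment to `M` makes `d (w n)`
  -- large enough for the second inequality.
  refine ⟨q.commitTo fun _ => M, q.commitTo_le _, max M N, fun n hn t ht => ?_⟩
  have hMn := hM n ((le_max_left _ _).trans hn)
  obtain ⟨u, hu, b, hb⟩ := t.exists_getElem? (w n)
  have hlt : z n < u.stem.length :=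
    hMn.trans_lt (List.getElem?_eq_some_iff.1 hb).1
  have ha := List.getElem?_eq_getElem hlt
  exact ⟨u, hu, _, _, sandwich_app ha, sandwich_app hb, (hz.1 (u.stem_mono hMn ha hb)).trans
    (hM _ (le_of_le_commitTo (hu.trans ht)
      ((hN n ((le_max_right _ _).trans hn)).trans hMn) hb))⟩

theorem evLE_of_leStar_sandwich {z w : ℕ → ℕ} (hz : NondecToInfty z) (hw : NondecToInfty w)
    {p : Dnd} (h : RealName.leStar (sandwich z) (sandwich w) p) : EvLE z w := by
  by_contra hzw
  obtain ⟨q, -, N, hN⟩ := RealName.exists_of_leStar h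
  obtain ⟨M, hM⟩ := hw.exists_ge q.stem.length
  obtain ⟨n, hn, hlt⟩ : ∃ n, max M N ≤ n ∧ w n < z n := by
    by_contra! hc
    exact hzw ⟨_, hc⟩
  -- Length exactly `w n + 1` decides `d (w n)` but leaves `d (z n)` open, since `w n < z n`.
  obtain ⟨r, hr, hl⟩ := q.exists_length_eq ((hM n ((le_max_left _ _).trans hn)).trans
    (w n).le_succ)
  have hb := List.getElem?_eq_getElem (show w n < r.stem.length by omega)
  obtain ⟨l, hl'⟩ := hz.exists_ge (w r.stem[w n] + 1)
  obtain ⟨u, hu, a, ha⟩ := (r.commitTo fun _ => l).exists_getElem? (z n)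
  have hur := hu.trans (r.commitTo_le _)
  have h1 := hN n ((le_max_right _ _).trans hn) u (hur.trans hr) _ _ (sandwich_app ha)
    (sandwich_app (prefix_getElem? hur.1 hb))
  have h2 := hl' a (le_of_le_commitTo hu (by omega) ha)
  omega

/-! ### Stems and compactness -/

/-- The nondecreasing finite sequences. -/
abbrev Stem : Type := {s : List ℕ // s.Pairwise (· ≤ ·)}

/-- The condition with stem `u` and commitment `f`. -/
def Stem.cond (u : Stem) (f : ℕ → ℕ) : Dnd := ⟨u.1, u.2, f⟩

/-- Only commitments below the length of `u` matter. So new values above a constant `K` bounding `f`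
there suffice, and "sufficiently large extension" can be expressed by constant commitments. -/
theorem cond_le_cond {t u : Stem} {f g : ℕ → ℕ} (hk : ∀ m, m < u.1.length → f m ≤ g m)
    (h : u.cond g ≤ t.cond g) : u.cond f ≤ t.cond f :=
  ⟨h.1, fun _ => le_rfl, fun m i hm hi =>
    (hk m (List.getElem?_eq_some_iff.1 hi).1).trans (h.2.2 m i hm hi)⟩

theorem cond_le_of_prefix {q : Dnd} {t u : Stem} {f : ℕ → ℕ} (hq : q.stem <+: t.1)
    (ht : t.1 <+: u.1) (h : u.cond f ≤ q) : t.cond f ≤ q :=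
  ⟨hq, h.2.1, fun m i hm hi => h.2.2 m i hm (prefix_getElem? ht hi)⟩

/-- Compactness of the space of nondecreasing sequences of length at most `k` with values in
`ω + 1`: a bound which exists for all sufficiently large end extensions of each stem exists
uniformly. -/
theorem exists_uniform_bound {α : Type} [SemilatticeSup α] (Q : Stem → α → Prop)
    (hQ : ∀ u x y, x ≤ y → Q u x → Q u y) (k : ℕ) (s : Stem)
    (h : ∀ t : Stem, s.1 <+: t.1 → ∃ (K : ℕ) (x : α), ∀ u : Stem, u.1.length ≤ k →
      (u.cond fun _ => K) ≤ (t.cond fun _ => K) → Q u x) :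
    ∃ x, ∀ u : Stem, s.1 <+: u.1 → u.1.length ≤ k → Q u x := by
  obtain ⟨e, he⟩ : ∃ e, k ≤ s.1.length + e := ⟨k, Nat.le_add_left _ _⟩
  induction e generalizing s with
  | zero =>
    obtain ⟨K, x, hx⟩ := h s (List.prefix_refl _)
    refine ⟨x, fun u hsu hu => ?_⟩
    obtain rfl : s = u := Subtype.ext (hsu.eq_of_length_le (by omega))
    exact hx s hu le_rfl
  | succ e ih =>
    obtain ⟨K, x, hx⟩ := h s (List.prefix_refl _)
    have hc : ∀ c, ∃ x, ∀ u : Stem, s.1 ++ [c] <+: u.1 → u.1.length ≤ k → Q u x := by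
      intro c
      by_cases hs : (s.1 ++ [c]).Pairwise (· ≤ ·)
      · refine ih ⟨_, hs⟩ (fun t ht => h t ((List.prefix_append _ _).trans ht)) ?_
        simp only [List.length_append, List.length_singleton]
        omega
      · exact ⟨x, fun u hu => absurd (List.Pairwise.sublist hu.sublist u.2) hs⟩
    choose y hy using hc
    classical
    have : Nonempty α := ⟨x⟩
    -- An extension whose next value is at least `K` has all its new values at least `K`, by
    -- monotonicity, and is covered by `x`. Only the finitely many next values below `K` remain,
    -- each covered by induction.
    obtain ⟨b, hb⟩ := Finset.exists_le (α := α) (insert x ((Finset.range K).image y))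
    refine ⟨b, fun u hsu hu => ?_⟩
    by_cases hK : (u.cond fun _ => K) ≤ (s.cond fun _ => K)
    · exact hQ u _ _ (hb _ (Finset.mem_insert_self _ _)) (hx u hu hK)
    · obtain ⟨v, hv⟩ := hsu
      cases v with
      | nil =>
        obtain rfl : s = u := Subtype.ext (by simpa using hv)
        exact absurd le_rfl hK
      | cons c v =>
        have hpre : s.1 ++ [c] <+: u.1 := ⟨v, by simpa using hv⟩
        have hcK : c < K := by
          by_contra! hcK
          refine hK ⟨⟨_, hv⟩, fun _ => le_rfl, fun m i hm hi => hcK.trans ?_⟩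
          exact (u.cond fun _ => K).stem_mono hm (prefix_getElem? hpre (by simp [Stem.cond])) hi
        exact hQ u _ _ (hb _ (Finset.mem_insert_of_mem
          (Finset.mem_image_of_mem y (Finset.mem_range.2 hcK)))) (hy c u hpre hu)

/-! ### Dominating reals -/

/-- The stem `u` favors `y(n) ≤ i`: no condition with stem `u` forces `y(n) > i`. -/
def Favors (y : RealName Dnd) (u : Stem) (n i : ℕ) : Prop :=
  ∀ f, ∃ r, r ≤ u.cond f ∧ ∃ b, b ≤ i ∧ y.app n b r

/-- Otherwise each pair of a stem and a length bound that fails yields favored bounds `G N` at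
arguments `n ≥ N`. As there are countably many pairs, one `g` in the ground model beats them all,
contradicting that `y` dominates `g`. -/
theorem exists_not_favors_of_dominating {y : RealName Dnd} {p : Dnd}
    (hp : RealName.dominating y p) :
    ∃ q, q ≤ p ∧ ∀ k, ∃ N, ∀ u : Stem, u.1.length ≤ k → u.cond q.commit ≤ q →
      ∀ n, N ≤ n → ∀ i, ¬ Favors y u n i := by
  have hG : ∀ a : Stem × ℕ, ∀ N, ∃ i,
      (∃ u : Stem, u.1.length ≤ a.2 ∧ (u.cond fun _ => N) ≤ (a.1.cond fun _ => N) ∧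
        ∃ n, N ≤ n ∧ ∃ i, Favors y u n i) →
      ∃ u : Stem, u.1.length ≤ a.2 ∧ (u.cond fun _ => N) ≤ (a.1.cond fun _ => N) ∧
        ∃ n, N ≤ n ∧ Favors y u n i := by
    intro a N
    by_cases h : ∃ u : Stem, u.1.length ≤ a.2 ∧ (u.cond fun _ => N) ≤ (a.1.cond fun _ => N) ∧
        ∃ n, N ≤ n ∧ ∃ i, Favors y u n i
    · obtain ⟨u, hu, hua, n, hn, i, hi⟩ := h
      exact ⟨i, fun _ => ⟨u, hu, hua, n, hn, hi⟩⟩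
    · exact ⟨0, fun h' => absurd h' h⟩
  choose G hG using hG
  obtain ⟨g, hg⟩ := exists_forall_lt_of_countable G
  obtain ⟨q, hq, M, hM⟩ := RealName.exists_of_leStar (hp g)
  have key : ∀ t : Stem, t.cond q.commit ≤ q → ∀ k, ∃ N, ∀ u : Stem, u.1.length ≤ k →
      (u.cond fun _ => N) ≤ (t.cond fun _ => N) → ∀ n, N ≤ n → ∀ i, ¬ Favors y u n i := by
    intro t ht k
    by_contra! hbad
    obtain ⟨N₀, hN₀⟩ := hg (t, k)
    -- `N₀` ensures `G N < g n`, `M` ensures `g n ≤ y n`, and the supremum keeps `u` compatible with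
    -- the commitments of `q`.
    obtain ⟨N, hN⟩ : ∃ N, N = max (max N₀ M) ((Finset.range k).sup q.commit) := ⟨_, rfl⟩
    obtain ⟨u, hu, hut, n, hn, i, hi⟩ := hbad N
    obtain ⟨u, hu, hut, n, hn, hfav⟩ := hG (t, k) N ⟨u, hu, hut, n, hn, i, hi⟩
    obtain ⟨r, hr, b, hb, hy⟩ := hfav q.commit
    have hle : u.cond q.commit ≤ t.cond q.commit := cond_le_cond (fun m hm => by
      rw [hN]
      exact (Finset.le_sup (Finset.mem_range.2 (hm.trans_le hu))).trans (le_max_right _ _)) hut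
    have h1 := hM n (by omega) r (hr.trans (hle.trans ht)) _ _ (RealName.check_app g n r) hy
    have h2 := hN₀ N (by omega) n hn
    omega
  refine ⟨q, hq, fun k => ?_⟩
  obtain ⟨N, hN⟩ := exists_uniform_bound
    (fun u N => u.cond q.commit ≤ q → ∀ n, N ≤ n → ∀ i, ¬ Favors y u n i)
    (fun u x y hxy h hu n hn => h hu n (hxy.trans hn)) k ⟨q.stem, q.nondec⟩ (fun t hqt => by
      by_cases ht : t.cond q.commit ≤ q
      · obtain ⟨N, hN⟩ := key t ht k
        exact ⟨N, N, fun u hu hut _ => hN u hu hut⟩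
      · exact ⟨0, 0, fun u _ hut huq => absurd (cond_le_of_prefix hqt hut.1 huq) ht⟩)
  exact ⟨N, fun u hu huq => hN u huq.1 hu huq⟩

/-- Each such stem has its own commitment forcing `y n > i`; compactness merges these infinitely
many commitments into one. -/
theorem exists_commit_of_not_favors {y : RealName Dnd} {q : Dnd} {k n i : ℕ}
    (h : ∀ u : Stem, u.1.length ≤ k → u.cond q.commit ≤ q → ¬ Favors y u n i) :
    ∃ f : ℕ → ℕ, ∀ u : Stem, u.1.length ≤ k → u.cond q.commit ≤ q →
      ∀ r, r ≤ u.cond f → ∀ b, y.app n b r → i < b := by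
  obtain ⟨f, hf⟩ := exists_uniform_bound
    (fun u f => u.cond q.commit ≤ q → u.1.length ≤ k →
      ∀ r, r ≤ u.cond f → ∀ b, y.app n b r → i < b)
    (fun u f g hfg h hu huk r hr => h hu huk r ⟨hr.1, fun m => (hfg m).trans (hr.2.1 m),
      fun m j hm hj => (hfg m).trans (hr.2.2 m j hm hj)⟩) k ⟨q.stem, q.nondec⟩ (fun t hqt => by
      by_cases ht : t.cond q.commit ≤ q ∧ t.1.length ≤ k
      · have hnf := h t ht.2 ht.1
        unfold Favors at hnf
        push Not at hnf
        obtain ⟨f, hf⟩ := hnf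
        -- Extensions of `t` with new values above this bound obey `f`, so the commitment found for
        -- `t` also works for them.
        refine ⟨(Finset.range k).sup f, f, fun u hu hut _ _ r hr b hb => ?_⟩
        by_contra! hbi
        refine hf r (hr.trans (cond_le_cond (fun m hm => ?_) hut)) b hbi hb
        exact Finset.le_sup (Finset.mem_range.2 (hm.trans_le hu))
      · exact ⟨0, 0, fun u hu hut huq _ => absurd
          ⟨cond_le_of_prefix hqt hut.1 huq, hut.1.length_le.trans hu⟩ ht⟩)
  exact ⟨f, fun u hu huq => hf u huq.1 hu huq hu⟩

/-- The reals `z ∘ d ∘ z` are coinitial in the dominating reals. -/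
theorem exists_sandwich_leStar {y : RealName Dnd} {p : Dnd} (hp : RealName.dominating y p) :
    ∃ r, r ≤ p ∧ ∃ z, NondecToInfty z ∧ RealName.leStar (sandwich z) y r := by
  obtain ⟨q, hq, hN⟩ := exists_not_favors_of_dominating hp
  choose N hN using hN
  obtain ⟨z₁, hz₁, n₀, hn₀⟩ := NondecToInfty.exists_apply_le N
  have hf : ∀ n i, ∃ f : ℕ → ℕ, n₀ ≤ n → ∀ u : Stem, u.1.length ≤ z₁ n → u.cond q.commit ≤ q →
      ∀ r, r ≤ u.cond f → ∀ b, y.app n b r → i < b := by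
    intro n i
    by_cases hn : n₀ ≤ n
    · obtain ⟨f, hf⟩ := exists_commit_of_not_favors (i := i)
        (fun u hu huq => hN (z₁ n) u hu huq n (hn₀ n hn) i)
      exact ⟨f, fun _ => hf⟩
    · exact ⟨0, fun h => absurd h hn⟩
  choose f hf using hf
  have hB : ∀ m, ∃ B, ∀ n i l, z₁ n ≤ m → i ≤ m → l ≤ m → f n i l ≤ B := by
    intro m
    obtain ⟨A, hA⟩ := hz₁.exists_ge (m + 1)
    refine ⟨((Finset.range A) ×ˢ (Finset.range (m + 1)) ×ˢ (Finset.range (m + 1))).sup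
      fun x => f x.1 x.2.1 x.2.2, fun n i l hn hi hl => ?_⟩
    refine Finset.le_sup (f := fun x : ℕ × ℕ × ℕ => f x.1 x.2.1 x.2.2) (b := (n, i, l)) ?_
    simp only [Finset.mem_product, Finset.mem_range]
    refine ⟨?_, by omega, by omega⟩
    by_contra! h
    exact absurd (hA n h) (by omega)
  choose B hB using hB
  obtain ⟨z₂, hz₂, v₀, hv₀⟩ := NondecToInfty.exists_apply_le B
  -- The commitment to `B` handles late positions of `d`; `v₀` makes `B (z₂ v) ≤ v` available for `v
  -- = d (z₁ n)`.
  refine ⟨q.commitTo fun m => max (B m) v₀, (q.commitTo_le _).trans hq, _, hz₁.min hz₂,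
    RealName.leStar_of_forall fun q' hq' => ?_⟩
  obtain ⟨n₁, hn₁⟩ := hz₁.exists_ge q.stem.length
  refine ⟨q', le_rfl, max n₀ n₁, fun n hn t ht => ?_⟩
  obtain ⟨t₁, ht₁, b, hb⟩ := y.exists_app n t
  obtain ⟨t₂, ht₂, v, hv⟩ := t₁.exists_getElem? (z₁ n)
  have htq : t₂ ≤ q.commitTo fun m => max (B m) v₀ :=
    ((ht₂.trans ht₁).trans ht).trans hq'
  have htq' : t₂ ≤ q := htq.trans (q.commitTo_le _)
  have hlen : z₁ n < t₂.stem.length := (List.getElem?_eq_some_iff.1 hv).1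
  have hqn : q.stem.length ≤ z₁ n := hn₁ n ((le_max_right _ _).trans hn)
  have hbig := le_of_le_commitTo htq hqn hv
  have hw := List.getElem?_eq_getElem ((min_le_left (z₁ n) (z₂ n)).trans_lt hlen)
  refine ⟨t₂, ht₂.trans ht₁, _, b, sandwich_app (z := fun n => min (z₁ n) (z₂ n)) hw,
    y.app_mono ht₂ hb, (min_le_right _ _).trans
      ((hz₂.1 (t₂.stem_mono (min_le_left _ _) hw hv)).trans ?_)⟩
  have hpre : t₂.stem.take (z₁ n) <+: t₂.stem := List.take_prefix _ _
  let u : Stem := ⟨t₂.stem.take (z₁ n), t₂.nondec.sublist hpre.sublist⟩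
  have hul : u.1.length = z₁ n := by simp [u, hlen.le]
  have huq : u.cond q.commit ≤ q := by
    refine ⟨List.prefix_of_prefix_length_le htq'.1 hpre (hqn.trans hul.ge),
      fun _ => le_rfl, fun m i hm hi => htq'.2.2 m i hm (prefix_getElem? hpre hi)⟩
  -- The values of `d` from `z₁ n` on obey `f n (z₂ v)`: at `m ≤ z₂ v` because `B (z₂ v) ≤ v ≤ d m`,
  -- and at `m ≥ z₂ v` because `B m ≤ d m`. Monotonicity of `d` is essential in the first case.
  have hle : t₂.commitTo (f n (z₂ v)) ≤ u.cond (f n (z₂ v)) := by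
    refine ⟨hpre, fun _ => le_sup_right, fun m i hm hi => ?_⟩
    have hm' : z₁ n ≤ m := hul ▸ hm
    rcases le_total m (z₂ v) with h | h
    · exact (hB (z₂ v) n (z₂ v) m (hm'.trans h) le_rfl h).trans
        ((hv₀ v ((le_max_right _ _).trans hbig)).trans (t₂.stem_mono hm' hv hi))
    · exact (hB m n (z₂ v) m hm' h le_rfl).trans
        ((le_max_left _ _).trans (le_of_le_commitTo htq (hqn.trans hm') hi))
  exact (hf n (z₂ v) ((le_max_left _ _).trans hn) u hul.le huq _ hle b
    (y.app_mono ((t₂.commitTo_le _).trans ht₂) hb)).le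

/-! ### The cofinal isomorphism -/

theorem sandwichMap_mem {C : Set (ℕ → ℕ)} {ρ : (ℕ → ℕ) → ℕ → ℕ} {z : ℕ → ℕ} (hz : z ∈ C)
    (p : Dnd) : (sandwichMap C ρ).mem (RealName.check z) (sandwich (ρ z)) p :=
  fun q _ => ⟨q, le_rfl, ⟨z, hz⟩, RealName.eq_refl _ _, RealName.eq_refl _ _⟩

/-- Both `ρ` and the order on the dominating reals are reversed, so the composite preserves and
reflects `≤*`. Antisymmetry on `C` (`hinj`) turns reflection of the order into injectivity. -/
theorem isCofinalIso_sandwichMap {C : Set (ℕ → ℕ)} {ρ : (ℕ → ℕ) → ℕ → ℕ}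
    (hC : ∀ f : ℕ → ℕ, ∃ z ∈ C, EvLE f z) (hρ : ∀ z ∈ C, NondecToInfty (ρ z))
    (hanti : ∀ z ∈ C, ∀ w ∈ C, EvLE z w ↔ EvLE (ρ w) (ρ z))
    (hcoin : ∀ w : ℕ → ℕ, NondecToInfty w → ∃ z ∈ C, EvLE (ρ z) w)
    (hinj : ∀ z ∈ C, ∀ w ∈ C, EvLE z w → EvLE w z → z = w) :
    Sentence.Forced (isCofinalIso (sandwichMap C ρ) RealName.inGround RealName.leStar
      RealName.dominating fun x y => RealName.leStar y x) := by
  intro p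
  -- Strengthening the condition decides the ground model parameters of both pairs, reducing each
  -- clause to a statement about `check` and `sandwich` names.
  have pair : ∀ {x y x' y' : RealName Dnd} {q r : Dnd}, r ≤ q →
      (sandwichMap C ρ).mem x y q → (sandwichMap C ρ).mem x' y' r →
      ∃ s, s ≤ r ∧ ∃ z ∈ C, ∃ w ∈ C, RealName.eq x (RealName.check z) s ∧
        RealName.eq y (sandwich (ρ z)) s ∧ RealName.eq x' (RealName.check w) s ∧
        RealName.eq y' (sandwich (ρ w)) s := by
    intro x y x' y' q r hr h h'
    obtain ⟨s, hs, z, hx, hy⟩ := h r hr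
    obtain ⟨t, ht, w, hx', hy'⟩ := h' s hs
    exact ⟨t, ht.trans hs, z.1, z.2, w.1, w.2, RealName.eq_mono ht hx,
      RealName.eq_mono ht hy, hx', hy'⟩
  refine ⟨fun x y q _ h => ⟨fun r hr => ?_, fun f => RealName.leStar_of_dense fun r hr => ?_⟩,
    fun x y x' y' q hq h r hr h' => ⟨fun s hs he => RealName.eq_of_dense fun t ht => ?_,
      fun s hs he => RealName.eq_of_dense fun t ht => ?_⟩,
    fun x y x' y' q hq h r hr h' => ⟨fun s hs he => RealName.leStar_of_dense fun t ht => ?_,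
      fun s hs he => RealName.leStar_of_dense fun t ht => ?_⟩,
    fun a q hq ha r hr => ?_, fun b q hq hb r hr => ?_⟩
  · obtain ⟨s, hs, z, hx, -⟩ := h r hr
    exact ⟨s, hs, z.1, hx⟩
  · obtain ⟨s, hs, z, -, hy⟩ := h r hr
    exact ⟨s, hs, (RealName.leStar_congr (RealName.eq_refl _ _) hy).2
      (dominating_sandwich (hρ z.1 z.2) s f)⟩
  · obtain ⟨u, hu, z, hz, w, hw, hx, hy, hx', hy'⟩ :=
      pair ((ht.trans hs).trans hr) h ((sandwichMap C ρ).mem_mono (ht.trans hs) h')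
    obtain rfl : z = w := RealName.eq_of_eq_check (RealName.eq_trans (RealName.eq_symm hx)
      (RealName.eq_trans (RealName.eq_mono (hu.trans ht) he) hx'))
    exact ⟨u, hu, RealName.eq_trans hy (RealName.eq_symm hy')⟩
  · obtain ⟨u, hu, z, hz, w, hw, hx, hy, hx', hy'⟩ :=
      pair ((ht.trans hs).trans hr) h ((sandwichMap C ρ).mem_mono (ht.trans hs) h')
    have hyy := RealName.eq_trans (RealName.eq_symm hy)
      (RealName.eq_trans (RealName.eq_mono (hu.trans ht) he) hy')
    obtain rfl : z = w := hinj z hz w hw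
      ((hanti z hz w hw).2 (evLE_of_leStar_sandwich (hρ w hw) (hρ z hz)
        (RealName.leStar_of_eq (RealName.eq_symm hyy))))
      ((hanti w hw z hz).2 (evLE_of_leStar_sandwich (hρ z hz) (hρ w hw)
        (RealName.leStar_of_eq hyy)))
    exact ⟨u, hu, RealName.eq_trans hx (RealName.eq_symm hx')⟩
  · obtain ⟨u, hu, z, hz, w, hw, hx, hy, hx', hy'⟩ :=
      pair ((ht.trans hs).trans hr) h ((sandwichMap C ρ).mem_mono (ht.trans hs) h')
    exact ⟨u, hu, (RealName.leStar_congr hy' hy).2 (leStar_sandwich (hρ w hw)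
      ((hanti z hz w hw).1 (RealName.evLE_of_leStar_check ((RealName.leStar_congr hx hx').1
        (RealName.leStar_mono (hu.trans ht) he)))) u)⟩
  · obtain ⟨u, hu, z, hz, w, hw, hx, hy, hx', hy'⟩ :=
      pair ((ht.trans hs).trans hr) h ((sandwichMap C ρ).mem_mono (ht.trans hs) h')
    exact ⟨u, hu, (RealName.leStar_congr hx hx').2 (RealName.leStar_check
      ((hanti z hz w hw).2 (evLE_of_leStar_sandwich (hρ w hw) (hρ z hz)
        ((RealName.leStar_congr hy' hy).1 (RealName.leStar_mono (hu.trans ht) he)))) u)⟩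
  · obtain ⟨s, hs, f, hf⟩ := ha r hr
    obtain ⟨z, hz, hfz⟩ := hC f
    exact ⟨s, hs, RealName.check z, fun t ht => ⟨t, le_rfl, sandwich (ρ z), sandwichMap_mem hz t,
      (RealName.leStar_congr (RealName.eq_mono ht hf) (RealName.eq_refl _ _)).2
        (RealName.leStar_check hfz t)⟩⟩
  · obtain ⟨s, hs, w, hw, hle⟩ := exists_sandwich_leStar
      (show RealName.dominating b r from fun f => RealName.leStar_mono hr (hb f))
    obtain ⟨z, hz, hzw⟩ := hcoin w hw
    exact ⟨s, hs, RealName.check z, fun t ht => ⟨t, le_rfl, sandwich (ρ z), sandwichMap_mem hz t,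
      RealName.leStar_trans (leStar_sandwich (hρ z hz) hzw t) (RealName.leStar_mono ht hle)⟩⟩

end Dnd

open Sentence RealName in
theorem mainTheorem6 :
    -- in `V[d]`, `(V ∩ ω^ω, ≤*)` and (dominating reals, `*≥`) are cofinally isomorphic
    Forced (cofinallyIsomorphic (P := Dnd) inGround leStar dominating (fun x y => leStar y x)) ∧
    -- a cofinal isomorphism is `z ↦ z' ∘ d ∘ z'` for a reparametrization `z ↦ z'` in `V`
    (∃ (C : Set (ℕ → ℕ)) (ρ : (ℕ → ℕ) → (ℕ → ℕ)),
      (∀ f : ℕ → ℕ, ∃ z ∈ C, EvLE f z) ∧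
      (∀ z ∈ C, NondecToInfty (ρ z)) ∧
      (∀ z₀ ∈ C, ∀ z₁ ∈ C, EvLE z₀ z₁ ↔ EvLE (ρ z₁) (ρ z₀)) ∧
      (∀ w : ℕ → ℕ, NondecToInfty w → ∃ z ∈ C, EvLE (ρ z) w) ∧
      Forced (isCofinalIso (Dnd.sandwichMap C ρ) inGround leStar
        dominating (fun x y => leStar y x))) ∧
    -- `z ↦ z ∘ d ∘ z` maps the nondecreasing unbounded reals of `V` to dominating reals,
    -- preserves and reflects `≤*`, and its range is cofinal in (dominating reals, `*≥`)
    (∀ z : ℕ → ℕ, NondecToInfty z → Forced (dominating (Dnd.sandwich z))) ∧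
    (∀ z₀ z₁ : ℕ → ℕ, NondecToInfty z₀ → NondecToInfty z₁ →
      Forced (iff (leStar (check z₀) (check z₁))
        (leStar (Dnd.sandwich z₀) (Dnd.sandwich z₁)))) ∧
    Forced (all fun y : RealName Dnd => imp (dominating y)
      (ex fun z : {z : ℕ → ℕ // NondecToInfty z} => leStar (Dnd.sandwich z.1) y)) := by
  have hC : ∀ f : ℕ → ℕ, ∃ z ∈ nondecReps, EvLE f z := by
    intro f
    obtain ⟨z, hz, hfz⟩ := NondecToInfty.exists_le f
    obtain ⟨w, hw, -, hzw⟩ := exists_mem_nondecReps hz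
    exact ⟨w, hw, EvLE.trans ⟨0, fun n _ => hfz n⟩ hzw⟩
  have hρ : ∀ z ∈ nondecReps, NondecToInfty (genInv z) :=
    fun z hz => (nondecToInfty_of_mem_nondecReps hz).genInv
  have hanti : ∀ z ∈ nondecReps, ∀ w ∈ nondecReps, EvLE z w ↔ EvLE (genInv w) (genInv z) :=
    fun z hz w hw =>
      (nondecToInfty_of_mem_nondecReps hz).evLE_genInv_iff (nondecToInfty_of_mem_nondecReps hw)
  have hcoin : ∀ w : ℕ → ℕ, NondecToInfty w → ∃ z ∈ nondecReps, EvLE (genInv z) w := by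
    intro w hw
    -- As `genInv` is an involution, inverting a representative of `genInv w` recovers `w` up to
    -- eventual equality.
    obtain ⟨z, hz, -, hle⟩ := exists_mem_nondecReps hw.genInv
    refine ⟨z, hz, ?_⟩
    have := hw.genInv.evLE_genInv (nondecToInfty_of_mem_nondecReps hz) hle
    rwa [hw.genInv_genInv] at this
  have hiso := Dnd.isCofinalIso_sandwichMap hC hρ hanti hcoin
    fun z hz w hw => eq_of_mem_nondecReps hz hw
  refine ⟨fun p q _ => ⟨q, le_rfl, _, hiso q⟩, ⟨_, _, hC, hρ, hanti, hcoin, hiso⟩,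
    fun z hz => Dnd.dominating_sandwich hz, fun z₀ z₁ hz₀ hz₁ p =>
      ⟨fun q _ h => Dnd.leStar_sandwich hz₀ (evLE_of_leStar_check h) q,
        fun q _ h => leStar_check (Dnd.evLE_of_leStar_sandwich hz₀ hz₁ h) q⟩,
    fun p y q _ hy r hr => ?_⟩
  obtain ⟨s, hs, z, hz, hle⟩ := Dnd.exists_sandwich_leStar
    (show dominating y r from fun f => leStar_mono hr (hy f))
  exact ⟨s, hs, ⟨z, hz⟩, hle⟩
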